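/- All semigroups are nonempty. A \emph{variety} is a class of semigroups closed under homomorphic images, subsemigroups and arbitrary direct products. A semigroup is \emph{periodic} if each of its monogenic subsemigroups is finite, \emph{locally finite} if each of its finitely generated subsemigroups is finite, and has \emph{central idempotents} if $es=se$ for every idempotent $e$ and every element $s$. A \emph{nilsemigroup} is a semigroup $S$ with an element $0$ such that $s0=0s=0$ for all $s\in S$ and some power of each element of $S$ equals $0$. Two elements $x,y$ of a semigroup $S$ are $\mathcal{J}$-related if $S^1xS^1=S^1yS^1$, where $S^1=S$ if $S$ has an identity element and $S^1$ is $S$ with an identity element adjoined otherwise. A variety is \emph{locally $\mathcal{J}$-finite} if each finitely generated semigroup in it has only finitely many $\mathcal{J}$-classes. A \emph{Novikov--Adian group} is an infinite finitely generated group of finite exponent. For a group $G$, let $\overline{G}=\{\overline{g}\mid g\in G\}$ be a copy of the set $G$ disjoint from $G$ (namely, the set of cosets of the trivial subgroup of $G$), and let $0$ be a fresh symbol. The semigroup $L^\flat(G)$ is the set $G\cup\overline{G}\cup\{0\}$ with the multiplication that extends that of $G$ and satisfies $g\,\overline{h}=\overline{gh}$ and $\overline{g}\,h=\overline{g}$ for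 all $g,h\in G$, all other products being $0$. The semigroup $R^\flat(G)$ is the same set with the multiplication that extends that of $G$ and satisfies $g\,\overline{h}=\overline{h}$ and $\overline{g}\,h=\overline{gh}$ for all $g,h\in G$, all other products being $0$. \textbf{Theorem.} Let $\mathbf{V}$ be a variety of semigroups all of whose members are periodic semigroups with central idempotents. Then $\mathbf{V}$ is locally $\mathcal{J}$-finite if and only if all nilsemigroups in $\mathbf{V}$ are locally finite and, for every Novikov--Adian group $G$, $\mathbf{V}$ contains neither $L^\flat(G)$ nor $R^\flat(G)$. -/

import Mathlib

universe u

namespace SemigroupVarieties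

/-- A semigroup is finitely generated if it is generated, as a semigroup, by a finite subset. -/
def FinitelyGenerated (S : Type u) [Semigroup S] : Prop :=
  ∃ A : Set S, A.Finite ∧ Subsemigroup.closure A = ⊤

/-- A semigroup is locally finite if each of its finitely generated subsemigroups is finite. -/
def LocallyFinite (S : Type u) [Semigroup S] : Prop :=
  ∀ A : Set S, A.Finite → (Subsemigroup.closure A : Set S).Finite

/-- A semigroup is periodic if each of its monogenic subsemigroups is finite. -/
def Periodic (S : Type u) [Semigroup S] : Prop :=
  ∀ x : S, (Subsemigroup.closure {x} : Set S).Finite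

/-- Every idempotent commutes with every element. -/
def CentralIdempotents (S : Type u) [Semigroup S] : Prop :=
  ∀ e s : S, IsIdempotentElem e → e * s = s * e

/-- A semigroup with a zero such that a (positive) power of every element is zero. The power is
computed in `WithOne S`, in which `S` is embedded. -/
def IsNil (S : Type u) [Semigroup S] : Prop :=
  ∃ z : S, (∀ s : S, s * z = z ∧ z * s = z) ∧
    ∀ s : S, ∃ n : ℕ, 0 < n ∧ (s : WithOne S) ^ n = (z : WithOne S)

/-- The principal two-sided ideal `S¹ x S¹` of `S`, with the multipliers taken from the semigroup
with a fresh identity adjoined. If `S` already has an identity, the fresh identity adds nothing,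
see `principalIdeal_of_identity`. -/
def principalIdeal {S : Type u} [Semigroup S] (x : S) : Set S :=
  {y | ∃ a b : WithOne S, (y : WithOne S) = a * x * b}

/-- If `S` has an identity, then `S¹ x S¹` is just `S x S`. -/
theorem principalIdeal_of_identity {S : Type u} [Semigroup S] (e : S)
    (he : ∀ s : S, e * s = s ∧ s * e = s) (x : S) :
    principalIdeal x = {y | ∃ a b : S, y = a * x * b} := by
  ext y
  constructor
  · rintro ⟨a, b, h⟩
    have key : ∀ c : WithOne S, ∃ c' : S, (∀ s : S, c * (s : WithOne S) = ((c' * s : S) : WithOne S))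
        ∧ ∀ s : S, (s : WithOne S) * c = ((s * c' : S) : WithOne S) := by
      intro c
      refine WithOne.cases_on c ?_ ?_
      · exact ⟨e, fun s => by simp [(he s).1], fun s => by simp [(he s).2]⟩
      · exact fun c => ⟨c, fun s => rfl, fun s => rfl⟩
    obtain ⟨a', ha, -⟩ := key a
    obtain ⟨b', -, hb⟩ := key b
    rw [ha, hb] at h
    exact ⟨a', b', WithOne.coe_inj.mp h⟩
  · rintro ⟨a, b, rfl⟩
    exact ⟨a, b, rfl⟩

/-- Green's relation `J`: two elements are related if they generate the same ideal. -/
def greenJ (S : Type u) [Semigroup S] : Setoid S where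
  r x y := principalIdeal x = principalIdeal y
  iseqv := ⟨fun _ => rfl, fun h => h.symm, fun h k => h.trans k⟩

/-- A semigroup is `J`-finite if it has only finitely many `J`-classes. -/
def JFinite (S : Type u) [Semigroup S] : Prop :=
  Finite (Quotient (greenJ S))

/-- A class of semigroups is a variety if it is closed under homomorphic images, (nonempty)
subsemigroups and arbitrary direct products (including the empty product, the trivial
semigroup). In particular, it is closed under isomorphisms and is not empty. -/
structure IsVariety (V : ∀ (S : Type u) [Semigroup S], Prop) : Prop where
  of_surjective : ∀ {S T : Type u} [Semigroup S] [Semigroup T] (f : S →ₙ* T),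
    Function.Surjective f → V S → V T
  subsemigroup : ∀ {S : Type u} [Semigroup S] (T : Subsemigroup S),
    (T : Set S).Nonempty → V S → V T
  pi : ∀ {I : Type u} (S : I → Type u) [∀ i, Semigroup (S i)],
    (∀ i, V (S i)) → V (∀ i, S i)

/-- A class of semigroups is locally `J`-finite if each of its finitely generated members is
`J`-finite. -/
def LocallyJFinite (V : ∀ (S : Type u) [Semigroup S], Prop) : Prop :=
  ∀ (S : Type u) [Semigroup S], V S → FinitelyGenerated S → JFinite S

/-- Novikov--Adian groups: infinite finitely generated groups of finite exponent. -/
def IsNovikovAdian (G : Type u) [Group G] : Prop :=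
  Infinite G ∧ Group.FG G ∧ Monoid.ExponentExists G

/-- The underlying set of `L♭_H(G)`: the disjoint union of `G`, the set of left cosets `gH`, and a
fresh zero. -/
inductive LFlatSub (G : Type u) [Group G] (H : Subgroup G) : Type u
  | unit (g : G) : LFlatSub G H
  | coset (c : G ⧸ H) : LFlatSub G H
  | zero : LFlatSub G H

namespace LFlatSub

variable {G : Type u} [Group G] {H : Subgroup G}

/-- Products in `G` are kept, `g₁(g₂H) = g₁g₂H`, `(g₁H)g₂ = g₁H`, all other products are `0`. -/
def mul : LFlatSub G H → LFlatSub G H → LFlatSub G H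
  | unit g₁, unit g₂ => unit (g₁ * g₂)
  | unit g, coset c => coset (g • c)
  | coset c, unit _ => coset c
  | _, _ => zero

instance : Semigroup (LFlatSub G H) where
  mul := mul
  mul_assoc a b c := by
    change mul (mul a b) c = mul a (mul b c)
    cases a <;> cases b <;> cases c <;> simp [mul, mul_assoc, mul_smul]

end LFlatSub

/-- The set of right cosets `Hg` of `H` in `G`. -/
abbrev RightCosets (G : Type u) [Group G] (H : Subgroup G) : Type u :=
  Quotient (QuotientGroup.rightRel H)

/-- The right action of `G` on right cosets: `(Hg)k = H(gk)`. -/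
def RightCosets.act {G : Type u} [Group G] {H : Subgroup G} (c : RightCosets G H) (k : G) :
    RightCosets G H :=
  Quotient.map (fun g => g * k)
    (fun a b h => by
      change QuotientGroup.rightRel H _ _
      replace h : QuotientGroup.rightRel H a b := h
      rw [QuotientGroup.rightRel_apply] at h ⊢
      simpa [mul_assoc] using h) c

theorem RightCosets.act_act {G : Type u} [Group G] {H : Subgroup G} (c : RightCosets G H)
    (k l : G) : (c.act k).act l = c.act (k * l) := by
  induction c using Quotient.inductionOn with
  | h g => simp [RightCosets.act, mul_assoc]

/-- The underlying set of `R♭_H(G)`: the disjoint union of `G`, the set of right cosets `Hg`, and a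
fresh zero. -/
inductive RFlatSub (G : Type u) [Group G] (H : Subgroup G) : Type u
  | unit (g : G) : RFlatSub G H
  | coset (c : RightCosets G H) : RFlatSub G H
  | zero : RFlatSub G H

namespace RFlatSub

variable {G : Type u} [Group G] {H : Subgroup G}

/-- Products in `G` are kept, `(Hg₁)g₂ = Hg₁g₂`, `g₁(Hg₂) = Hg₂`, all other products are `0`. -/
def mul : RFlatSub G H → RFlatSub G H → RFlatSub G H
  | unit g₁, unit g₂ => unit (g₁ * g₂)
  | coset c, unit g => coset (c.act g)
  | unit _, coset c => coset c
  | _, _ => zero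

instance : Semigroup (RFlatSub G H) where
  mul := mul
  mul_assoc a b c := by
    change mul (mul a b) c = mul a (mul b c)
    cases a <;> cases b <;> cases c <;> simp [mul, mul_assoc, RightCosets.act_act]

end RFlatSub

/-- `L♭(G)` is `L♭_E(G)` for the trivial subgroup `E`. -/
abbrev LFlat (G : Type u) [Group G] : Type u := LFlatSub G ⊥

/-- `R♭(G)` is `R♭_E(G)` for the trivial subgroup `E`. -/
abbrev RFlat (G : Type u) [Group G] : Type u := RFlatSub G ⊥

end SemigroupVarieties

/-!
Varieties `V` of periodic semigroups with central idempotents: local `J`-finiteness.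

**Necessity.** A nilsemigroup is `J`-trivial, so a finitely generated one with finitely many
`J`-classes is finite (`LocallyJFinite.locallyFinite_of_isNil`). For an infinite finitely generated
group `G` of finite exponent, the square of `L♭(G)` has a finitely generated subsemigroup with
infinitely many `J`-classes (`LocallyJFinite.not_lFlat`), and `L♭(G)` is a divisor of a power of
`R♭(G)` (`IsVariety.lFlat_of_rFlat`).

**Sufficiency.** Only the exclusion of the `R♭(G)` is needed, because a variety that contains
`L♭(G)` contains `R♭(G)` as well. Let `S` be finitely generated in `V`. It has finitely many
idempotents (`IsVariety.finite_idempotents`). The elements fixed by no idempotent are the nonzero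
elements of a finitely generated nil Rees quotient, so there are finitely many of them. If `x` is
fixed by an idempotent, let `e` be the least one. Then `x` lies in the finitely generated monoid
`M = eS`, and no idempotent of `M` except `1 = e` fixes `x`. It remains to show that such elements
of `M` fall into finitely many orbits of the left action of the group of units `G = Mˣ`
(`IsVariety.exists_finite_orbits`).

Let `b` be a nonunit generator of `M` that is fixed by no proper idempotent, let
`H = {g ∈ G | b * g ∈ G * b}`, and let `N` be the normal core of `H`. The set `GbG` together with
`G` and a zero is a divisor of `M`; dividing by the left action of `G` leaves the right cosets
of `H`, and a power of the result contains the right cosets of `N`. So `V` contains `R♭(G/N)`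
(`IsVariety.rFlat_quotient_normalCore`). As `G` is finitely generated and has finite exponent,
`G/N` is finite (`IsVariety.exists_finite_transversal`), so `b * G` is contained in `G * b * R` for
a finite set `R`. Units in a product of generators can therefore be moved to the left: up to a left
unit factor, every nonunit outside the ideal of elements fixed by proper idempotents lies in the
subsemigroup generated by the finitely many `b * s` with `s ∈ R`. That subsemigroup is nil modulo
the ideal, and the local finiteness of nilsemigroups (`IsVariety.finite_closure_diff`) completes the
argument.
-/

namespace SemigroupVarieties

/-! ### Varieties and divisors -/

/-- A variety contains every divisor of each of its members: if the multiplicative relation `r`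
is single-valued and onto `T`, then its domain is a subsemigroup of `S` that `r` maps onto `T`. -/
theorem IsVariety.of_relation {V : ∀ (S : Type u) [Semigroup S], Prop} (hV : IsVariety V)
    {S T : Type u} [Semigroup S] [Semigroup T] [Nonempty T] (hS : V S) (r : S → T → Prop)
    (hr : ∀ s t t', r s t → r s t' → t = t')
    (hmul : ∀ s s' t t', r s t → r s' t' → r (s * s') (t * t'))
    (hsurj : ∀ t, ∃ s, r s t) : V T := by
  let D : Subsemigroup S :=
    { carrier := {s | ∃ t, r s t}
      mul_mem' := fun {a b} ⟨t, h⟩ ⟨t', h'⟩ => ⟨t * t', hmul a b t t' h h'⟩ }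
  have hD : V D := hV.subsemigroup D (by
    obtain ⟨s, hs⟩ := hsurj (Classical.arbitrary T)
    exact ⟨s, _, hs⟩) hS
  choose f hf using fun s : D => s.2
  refine hV.of_surjective (S := D) (T := T) ⟨f, fun a b => ?_⟩ (fun t => ?_) hD
  · exact hr _ _ _ (hf (a * b)) (hmul _ _ _ _ (hf a) (hf b))
  · obtain ⟨s, hs⟩ := hsurj t
    exact ⟨⟨s, t, hs⟩, hr _ _ _ (hf ⟨s, t, hs⟩) hs⟩

/-! ### Powers and idempotents in periodic semigroups -/

theorem exists_pow_of_mem_closure_singleton {M : Type*} [Monoid M] {x y : M}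
    (h : y ∈ Subsemigroup.closure {x}) : ∃ n : ℕ, 0 < n ∧ x ^ n = y := by
  induction h using Subsemigroup.closure_induction with
  | mem y hy => exact ⟨1, one_pos, by rw [pow_one, Set.mem_singleton_iff.1 hy]⟩
  | mul a b _ _ ha hb =>
    obtain ⟨m, hm, rfl⟩ := ha
    obtain ⟨n, hn, rfl⟩ := hb
    exact ⟨m + n, by omega, pow_add x m n⟩

/-- The elements of a monogenic subsemigroup are powers in the sense of `IsNil`. -/
theorem exists_coe_pow_of_mem_closure_singleton {S : Type*} [Semigroup S] {x y : S}
    (h : y ∈ Subsemigroup.closure {x}) : ∃ n : ℕ, 0 < n ∧ (x : WithOne S) ^ n = y := by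
  apply exists_pow_of_mem_closure_singleton
  have := Subsemigroup.mem_map_of_mem (WithOne.coeMulHom : S →ₙ* WithOne S) h
  rwa [MulHom.map_mclosure, Set.image_singleton] at this

theorem Periodic.exists_idempotent {S : Type u} [Semigroup S] (hS : Periodic S) (x : S) :
    ∃ e ∈ Subsemigroup.closure {x}, IsIdempotentElem e := by
  have : Finite (Subsemigroup.closure {x}) := hS x
  let _ : TopologicalSpace (Subsemigroup.closure {x}) := ⊥
  have : DiscreteTopology (Subsemigroup.closure {x}) := ⟨rfl⟩
  have : Nonempty (Subsemigroup.closure {x}) := ⟨⟨x, Subsemigroup.subset_closure rfl⟩⟩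
  obtain ⟨e, he⟩ := exists_idempotent_of_compact_t2_of_continuous_mul_left
    (M := Subsemigroup.closure {x}) (fun _ => continuous_of_discreteTopology)
  exact ⟨e, e.2, congrArg Subtype.val he⟩

/-- In a variety of periodic semigroups the exponents are uniform: the idempotent power of the
identity function in `M ^ M` works for all elements of `M` at once. -/
theorem IsVariety.exists_pow_idempotent {V : ∀ (S : Type u) [Semigroup S], Prop}
    (hV : IsVariety V) (hper : ∀ (S : Type u) [Semigroup S], V S → Periodic S)
    {M : Type u} [Monoid M] (hM : V M) :
    ∃ n : ℕ, 0 < n ∧ ∀ x : M, IsIdempotentElem (x ^ n) := by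
  obtain ⟨e, he, hi⟩ := (hper (M → M) (hV.pi (fun _ => M) fun _ => hM)).exists_idempotent id
  obtain ⟨n, hn, rfl⟩ := exists_pow_of_mem_closure_singleton he
  exact ⟨n, hn, fun x => congrFun hi x⟩

/-- Periodicity excludes one-sided inverses: `x * y = 1` makes the idempotent `x ^ n` equal
to `1`. -/
theorem isDedekindFiniteMonoid_of_pow {M : Type*} [Monoid M] {n : ℕ} (hn : 0 < n)
    (hpow : ∀ x : M, IsIdempotentElem (x ^ n)) : IsDedekindFiniteMonoid M where
  mul_eq_one_symm := by
    intro x y h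
    have h1 := pow_mul_pow_eq_one n h
    have h2 : x ^ n = 1 := by
      calc x ^ n = x ^ n * (x ^ n * y ^ n) := by rw [h1, mul_one]
        _ = 1 := by rw [← mul_assoc, (hpow x).eq, h1]
    obtain ⟨u, rfl⟩ := IsUnit.of_pow_eq_one h2 hn.ne'
    rw [Units.mul_eq_one_iff_inv_eq] at h
    rw [← h, Units.inv_mul]

/-- If the ideal `I` contains a power of each element of `⟨A⟩`, then the Rees quotient of `⟨A⟩` by
`I ∩ ⟨A⟩` is a finitely generated nilsemigroup of the variety, hence finite, and `⟨A⟩ \ I` embeds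
into it. -/
theorem IsVariety.finite_closure_diff {V : ∀ (S : Type u) [Semigroup S], Prop}
    (hV : IsVariety V)
    (hnil : ∀ (S : Type u) [Semigroup S], V S → IsNil S → LocallyFinite S)
    {S : Type u} [Semigroup S] (hS : V S) {A : Set S} (hA : A.Finite) (I : Set S)
    (hI : ∀ x ∈ I, ∀ s, s * x ∈ I ∧ x * s ∈ I)
    (hpow : ∀ s ∈ Subsemigroup.closure A, ∃ z ∈ Subsemigroup.closure {s}, z ∈ I) :
    ((Subsemigroup.closure A : Set S) \ I).Finite := by
  set T := Subsemigroup.closure A with hT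
  rcases (T : Set S).eq_empty_or_nonempty with hemp | ⟨s₀, hs₀⟩
  · rw [hemp]; simp
  obtain ⟨z₀, hz₀, hz₀I⟩ := hpow s₀ hs₀
  have hsub : ∀ s ∈ T, Subsemigroup.closure {s} ≤ T := fun s hs =>
    Subsemigroup.closure_le.2 (Set.singleton_subset_iff.2 hs)
  let z : T := ⟨z₀, hsub s₀ hs₀ hz₀⟩
  let c : Con T :=
    { r := fun x y => x = y ∨ ((x : S) ∈ I ∧ (y : S) ∈ I)
      iseqv := by
        refine ⟨fun _ => Or.inl rfl, ?_, ?_⟩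
        · rintro x y (h | ⟨h, k⟩)
          exacts [Or.inl h.symm, Or.inr ⟨k, h⟩]
        · rintro x y w (rfl | ⟨h, k⟩) (rfl | ⟨h', k'⟩)
          exacts [Or.inl rfl, Or.inr ⟨h', k'⟩, Or.inr ⟨h, k⟩, Or.inr ⟨h, k'⟩]
      mul' := by
        rintro w x y v (rfl | ⟨h, k⟩) (rfl | ⟨h', k'⟩)
        exacts [Or.inl rfl, Or.inr ⟨(hI _ h' _).1, (hI _ k' _).1⟩,
          Or.inr ⟨(hI _ h _).2, (hI _ k _).2⟩, Or.inr ⟨(hI _ h _).2, (hI _ k _).2⟩] }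
  let π : T →ₙ* c.Quotient := ⟨fun x => x, fun _ _ => rfl⟩
  have hπ : Function.Surjective π := fun q => Con.induction_on q fun x => ⟨x, rfl⟩
  have hπI : ∀ x y : T, (x : S) ∈ I → (y : S) ∈ I → π x = π y := fun x y hx hy =>
    (Con.eq c).2 (Or.inr ⟨hx, hy⟩)
  have hQ : V c.Quotient := hV.of_surjective π hπ (hV.subsemigroup T ⟨s₀, hs₀⟩ hS)
  have hQnil : IsNil c.Quotient := by
    refine ⟨π z, fun q => ?_, fun q => ?_⟩
    · obtain ⟨x, rfl⟩ := hπ q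
      rw [← map_mul, ← map_mul]
      exact ⟨hπI _ _ (hI _ hz₀I _).1 hz₀I, hπI _ _ (hI _ hz₀I _).2 hz₀I⟩
    · obtain ⟨x, rfl⟩ := hπ q
      obtain ⟨w, hw, hwI⟩ := hpow x x.2
      have hw' : (⟨w, hsub x x.2 hw⟩ : T) ∈ Subsemigroup.closure {x} := by
        have : Subsemigroup.closure {(x : S)} ≤
            (Subsemigroup.closure {x}).map (MulMemClass.subtype T) := by
          rw [MulHom.map_mclosure, Set.image_singleton]; rfl
        obtain ⟨y, hy, rfl⟩ := this hw
        exact hy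
      have := Subsemigroup.mem_map_of_mem π hw'
      rw [MulHom.map_mclosure, Set.image_singleton, hπI ⟨w, hsub x x.2 hw⟩ z hwI hz₀I] at this
      exact exists_coe_pow_of_mem_closure_singleton this
  have hfin : Finite c.Quotient := by
    have hA' : ((π '' ((↑) ⁻¹' A)) : Set c.Quotient).Finite :=
      (hA.preimage Subtype.val_injective.injOn).image π
    have h := hnil _ hQ hQnil _ hA'
    rw [← MulHom.map_mclosure] at h
    have htop : Subsemigroup.closure (((↑) : T → S) ⁻¹' A) = ⊤ :=
      Subsemigroup.closure_closure_coe_preimage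
    rw [htop] at h
    refine Set.finite_univ_iff.1 (h.subset fun q _ => ?_)
    obtain ⟨x, rfl⟩ := hπ q
    exact ⟨x, trivial, rfl⟩
  have : Finite ((T : Set S) \ I : Set S) := by
    refine Finite.of_injective (fun x => π ⟨x.1, x.2.1⟩) fun x y hxy => ?_
    rcases (Con.eq c).1 hxy with h | ⟨h, -⟩
    · exact Subtype.ext (congrArg (Subtype.val : T → S) h)
    · exact absurd h x.2.2
  exact Set.toFinite _

/-! ### Green's relation `J` -/

theorem greenJ_of_mul {S : Type u} [Semigroup S] {x y a b : S} (h : x = a * y) (k : y = b * x) :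
    greenJ S x y := by
  have aux : ∀ {x y a : S}, x = a * y → principalIdeal x ⊆ principalIdeal y := by
    rintro x y a rfl w ⟨p, q, hw⟩
    exact ⟨p * a, q, by rw [hw, WithOne.coe_mul, ← mul_assoc]⟩
  exact (aux h).antisymm (aux k)

theorem greenJ.exists_mul {S : Type u} [Semigroup S] {x y : S} (h : greenJ S x y) :
    ∃ a b : WithOne S, (x : WithOne S) = a * y * b := by
  have hx : x ∈ principalIdeal x := ⟨1, 1, by simp⟩
  have h' : principalIdeal x = principalIdeal y := h
  rwa [h'] at hx

theorem jFinite_of_finite {S : Type u} [Semigroup S] {F : Set S} (hF : F.Finite)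
    (h : ∀ x, ∃ y ∈ F, greenJ S x y) : JFinite S := by
  have : Finite F := hF
  refine Finite.of_surjective (fun y : F => Quotient.mk (greenJ S) y) fun q => ?_
  induction q using Quotient.inductionOn with
  | h x =>
    obtain ⟨y, hy, hxy⟩ := h x
    exact ⟨⟨y, hy⟩, Quotient.sound ((greenJ S).symm hxy)⟩

/-! ### Necessity: nilsemigroups -/

/-- Nilsemigroups are `J`-trivial: from `x = p * x * q` with `p` or `q` in the semigroup one gets
`x = p ^ n * x * q ^ n = 0`. -/
theorem IsNil.eq_of_greenJ {S : Type u} [Semigroup S] (hS : IsNil S) {x y : S}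
    (h : greenJ S x y) : x = y := by
  obtain ⟨z, hz, hpow⟩ := hS
  have absorb : ∀ w : WithOne S, (z : WithOne S) * w = z ∧ w * z = z := by
    intro w
    refine WithOne.cases_on w (by simp) fun s => ?_
    rw [← WithOne.coe_mul, ← WithOne.coe_mul, (hz s).1, (hz s).2]
    exact ⟨rfl, rfl⟩
  have one_of : ∀ p q : WithOne S, p * q = 1 → p = 1 ∧ q = 1 := by
    intro p q
    refine WithOne.cases_on p (fun h => ⟨rfl, by simpa using h⟩) fun p' => ?_
    refine WithOne.cases_on q (fun h => by simp at h) fun q' h => ?_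
    rw [← WithOne.coe_mul] at h
    exact absurd h WithOne.coe_ne_one
  obtain ⟨a, b, hx⟩ := greenJ.exists_mul h
  obtain ⟨c, d, hy⟩ := greenJ.exists_mul ((greenJ S).symm h)
  have hx' : (x : WithOne S) = (a * c) * x * (d * b) := by
    rw [hy] at hx
    simpa only [mul_assoc] using hx
  have iter : ∀ n : ℕ, (x : WithOne S) = (a * c) ^ n * x * (d * b) ^ n := by
    intro n
    induction n with
    | zero => simp
    | succ n ih =>
      calc (x : WithOne S) = (a * c) ^ n * ((a * c) * x * (d * b)) * (d * b) ^ n := by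
            rw [← hx']; exact ih
        _ = _ := by rw [pow_succ, pow_succ' (d * b)]; simp only [mul_assoc]
  have of_zero : (x : WithOne S) = z → x = y := by
    intro h0
    have : (y : WithOne S) = z := by rw [hy, h0, (absorb c).2, (absorb d).1]
    exact WithOne.coe_inj.1 (h0.trans this.symm)
  have of_coe : ∀ w : WithOne S, w = 1 ∨ ∃ n : ℕ, w ^ n = z := by
    intro w
    refine WithOne.cases_on w (Or.inl rfl) fun s => Or.inr ?_
    obtain ⟨n, -, hn⟩ := hpow s
    exact ⟨n, hn⟩
  rcases of_coe (a * c) with hac | ⟨n, hn⟩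
  · rcases of_coe (d * b) with hdb | ⟨n, hn⟩
    · rw [(one_of _ _ hac).2, (one_of _ _ hdb).1, one_mul, mul_one] at hy
      exact (WithOne.coe_inj.1 hy).symm
    · exact of_zero (by rw [iter n, hn, (absorb _).2])
  · exact of_zero (by rw [iter n, hn, (absorb _).1, (absorb _).1])

theorem IsNil.subsemigroup {S : Type u} [Semigroup S] (hS : IsNil S) (T : Subsemigroup S)
    (hT : (T : Set S).Nonempty) : IsNil T := by
  obtain ⟨z, hz, hpow⟩ := hS
  have coe_pow : ∀ (t : T) (n : ℕ), 0 < n → ((t : S) : WithOne S) ^ n = z →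
      ∃ w : T, (t : WithOne T) ^ n = w ∧ (w : S) = z := by
    intro t n hn h
    have : ∃ w : T, (t : WithOne T) ^ n = w := by
      induction n, hn using Nat.le_induction with
      | base => exact ⟨t, by simp⟩
      | succ m hm ih =>
        clear ih h
        induction m, hm using Nat.le_induction with
        | base => exact ⟨t * t, by rw [WithOne.coe_mul, pow_two]⟩
        | succ m hm ih =>
          obtain ⟨w, hw⟩ := ih
          exact ⟨w * t, by rw [pow_succ, hw, WithOne.coe_mul]⟩
    obtain ⟨w, hw⟩ := this
    refine ⟨w, hw, WithOne.coe_inj.1 ?_⟩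
    have := congrArg (WithOne.mapMulHom (MulMemClass.subtype T : T →ₙ* S)) hw
    rw [map_pow, WithOne.mapMulHom_coe, WithOne.mapMulHom_coe] at this
    rw [← h]
    exact this.symm
  obtain ⟨t₀, ht₀⟩ := hT
  obtain ⟨n, hn, h⟩ := hpow t₀
  obtain ⟨z', -, rfl⟩ := coe_pow ⟨t₀, ht₀⟩ n hn h
  refine ⟨z', fun s => ⟨Subtype.ext (hz s).1, Subtype.ext (hz s).2⟩, fun s => ?_⟩
  obtain ⟨n, hn, h⟩ := hpow s
  obtain ⟨w, hw, h'⟩ := coe_pow s n hn h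
  exact ⟨n, hn, by rw [hw, Subtype.ext h']⟩

theorem LocallyJFinite.locallyFinite_of_isNil {V : ∀ (S : Type u) [Semigroup S], Prop}
    (hV : IsVariety V) (hJ : LocallyJFinite V) {S : Type u} [Semigroup S] (hS : V S)
    (hnil : IsNil S) : LocallyFinite S := by
  intro A hA
  rcases (Subsemigroup.closure A : Set S).eq_empty_or_nonempty with h | hne
  · rw [h]; exact Set.finite_empty
  have hfg : FinitelyGenerated (Subsemigroup.closure A) :=
    ⟨_, hA.preimage Subtype.val_injective.injOn, Subsemigroup.closure_closure_coe_preimage⟩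
  have : Finite (Quotient (greenJ (Subsemigroup.closure A))) :=
    hJ _ (hV.subsemigroup _ hne hS) hfg
  have hT := hnil.subsemigroup _ hne
  exact Finite.of_injective
    (fun x : Subsemigroup.closure A => Quotient.mk (greenJ (Subsemigroup.closure A)) x)
    fun x y hxy => hT.eq_of_greenJ (Quotient.exact hxy)

/-! ### Necessity: the semigroups `L♭(G)` and `R♭(G)` -/

/-- The units `(k, k)` act on the pairs `(ḡ, h) ∈ R♭(G) × G` by `(ḡ, kh)` from the left and by
`(gk‾, hk)` from the right, so `hg⁻¹` is multiplied by `k` on the left and fixed on the right,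
as in `L♭(G)`. -/
theorem IsVariety.lFlat_of_rFlat {V : ∀ (S : Type u) [Semigroup S], Prop} (hV : IsVariety V)
    {G : Type u} [Group G] (h : V (RFlat G)) : V (LFlat G) := by
  have : Nonempty (LFlat G) := ⟨.zero⟩
  let r : (ULift.{u} Bool → RFlat G) → LFlat G → Prop := fun f t =>
    match t with
    | .unit k => f ⟨false⟩ = .unit k ∧ f ⟨true⟩ = .unit k
    | .coset c => ∃ g h : G, f ⟨false⟩ = .coset (Quotient.mk _ g) ∧ f ⟨true⟩ = .unit h ∧
        c = ((h * g⁻¹ : G) : G ⧸ (⊥ : Subgroup G))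
    | .zero => f ⟨false⟩ = .zero ∧ ∃ h, f ⟨true⟩ = .unit h
  refine hV.of_relation (hV.pi (fun _ => RFlat G) fun _ => h) r ?_ ?_ ?_
  · rintro s (k | c | _) (k' | c' | _) h h' <;>
      simp only [r] at h h'
    · obtain ⟨h1, -⟩ := h
      rw [h1] at h'
      simpa using h'.1
    · obtain ⟨g, l, hg, -⟩ := h'
      simp [h.1] at hg
    · simp [h.1] at h'
    · obtain ⟨g, l, hg, -⟩ := h
      simp [h'.1] at hg
    · obtain ⟨g, l, hg, hl, rfl⟩ := h
      obtain ⟨g', l', hg', hl', rfl⟩ := h'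
      rw [hg, RFlatSub.coset.injEq] at hg'
      rw [hl, RFlatSub.unit.injEq] at hl'
      have hgg := Quotient.exact hg'
      change QuotientGroup.rightRel (⊥ : Subgroup G) g g' at hgg
      rw [QuotientGroup.rightRel_apply, Subgroup.mem_bot, mul_inv_eq_one] at hgg
      rw [hl', hgg]
    · obtain ⟨g, l, hg, -⟩ := h
      simp [h'.1] at hg
    · simp [h'.1] at h
    · obtain ⟨g, l, hg, -⟩ := h'
      simp [h.1] at hg
    · rfl
  · rintro s s' (k | c | _) (k' | c' | _) h h' <;>
      simp only [r] at h h'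
    · exact ⟨by rw [Pi.mul_apply, h.1, h'.1]; rfl, by rw [Pi.mul_apply, h.2, h'.2]; rfl⟩
    · obtain ⟨g, l, hg, hl, rfl⟩ := h'
      refine ⟨g, k * l, by rw [Pi.mul_apply, h.1, hg]; rfl, by rw [Pi.mul_apply, h.2, hl]; rfl, ?_⟩
      rw [mul_assoc]; rfl
    · obtain ⟨h0, l, hl⟩ := h'
      exact ⟨by rw [Pi.mul_apply, h.1, h0]; rfl, k * l, by rw [Pi.mul_apply, h.2, hl]; rfl⟩
    · obtain ⟨g, l, hg, hl, rfl⟩ := h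
      refine ⟨g * k', l * k', by rw [Pi.mul_apply, h'.1, hg]; rfl,
        by rw [Pi.mul_apply, h'.2, hl]; rfl, ?_⟩
      rw [mul_inv_rev, mul_assoc, mul_inv_cancel_left]
    · obtain ⟨g, l, hg, hl, rfl⟩ := h
      obtain ⟨g', l', hg', hl', rfl⟩ := h'
      exact ⟨by rw [Pi.mul_apply, hg, hg']; rfl, l * l', by rw [Pi.mul_apply, hl, hl']; rfl⟩
    · obtain ⟨g, l, hg, hl, rfl⟩ := h
      obtain ⟨h0, l', hl'⟩ := h'
      exact ⟨by rw [Pi.mul_apply, hg, h0]; rfl, l * l', by rw [Pi.mul_apply, hl, hl']; rfl⟩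
    · obtain ⟨h0, l, hl⟩ := h
      exact ⟨by rw [Pi.mul_apply, h0, h'.1]; rfl, l * k', by rw [Pi.mul_apply, hl, h'.2]; rfl⟩
    · obtain ⟨h0, l, hl⟩ := h
      obtain ⟨g', l', hg', hl', rfl⟩ := h'
      exact ⟨by rw [Pi.mul_apply, h0, hg']; rfl, l * l', by rw [Pi.mul_apply, hl, hl']; rfl⟩
    · obtain ⟨h0, l, hl⟩ := h
      obtain ⟨h0', l', hl'⟩ := h'
      exact ⟨by rw [Pi.mul_apply, h0, h0']; rfl, l * l', by rw [Pi.mul_apply, hl, hl']; rfl⟩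
  · rintro (k | c | _)
    · exact ⟨fun _ => .unit k, rfl, rfl⟩
    · induction c using QuotientGroup.induction_on with
      | H g =>
        exact ⟨fun i => if i.down then .unit g else .coset (Quotient.mk _ 1), 1, g, by simp,
          by simp, by simp⟩
    · exact ⟨fun i => if i.down then .unit 1 else .zero, by simp, 1, by simp⟩

theorem LFlatSub.mul_eq_coset {G : Type u} [Group G] {H : Subgroup G} {x y : LFlatSub G H}
    {c : G ⧸ H} (h : x * y = .coset c) :
    (∃ g d, x = .unit g ∧ y = .coset d ∧ c = g • d) ∨ (∃ g, x = .coset c ∧ y = .unit g) := by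
  change LFlatSub.mul x y = _ at h
  rcases x with g | d | _ <;> rcases y with g' | d' | _ <;>
    simp only [LFlatSub.mul, LFlatSub.coset.injEq, reduceCtorEq] at h
  · exact Or.inl ⟨g, d', rfl, rfl, h.symm⟩
  · exact Or.inr ⟨g', by rw [h], rfl⟩

theorem LFlatSub.mul_eq_unit {G : Type u} [Group G] {H : Subgroup G} {x y : LFlatSub G H}
    {k : G} (h : x * y = .unit k) : ∃ g l, x = .unit g ∧ y = .unit l ∧ k = g * l := by
  change LFlatSub.mul x y = _ at h
  rcases x with g | d | _ <;> rcases y with g' | d' | _ <;>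
    simp only [LFlatSub.mul, LFlatSub.unit.injEq, reduceCtorEq] at h
  exact ⟨g, g', rfl, rfl, h.symm⟩

/-- In `L♭(G) × L♭(G)` consider the subsemigroup generated by the pairs `(g, g)`, by `(1̄, 1)` and
by `(1, 1̄)`. It contains `(1̄, h̄) = (1̄, 1)(h, h)(1, 1̄)` for every `h`. Its only pairs of units
are the `(g, g)`, which fix coset pairs from the right and preserve the quotient `p⁻¹q` of
`(p̄, q̄)` from the left. So the `(1̄, h̄)` lie in distinct `J`-classes. -/
theorem LocallyJFinite.not_lFlat {V : ∀ (S : Type u) [Semigroup S], Prop}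
    (hV : IsVariety V) (hJ : LocallyJFinite V) {G : Type u} [Group G] (hG : IsNovikovAdian G) :
    ¬ V (LFlat G) := by
  intro hL
  obtain ⟨hinf, hfg, -⟩ := hG
  obtain ⟨C, hC⟩ := (Group.fg_iff_monoid_fg.1 hfg).fg_top
  let P := ULift.{u} Bool → LFlat G
  let pair : LFlat G → LFlat G → P := fun x y i => if i.down then y else x
  have pair_mul : ∀ x y x' y', pair x y * pair x' y' = pair (x * x') (y * y') := by
    intro x y x' y'
    funext ⟨i⟩
    cases i <;> rfl
  let diag : G → P := fun g => pair (.unit g) (.unit g)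
  let a : P := pair (.coset (1 : G)) (.unit 1)
  let b : P := pair (.unit 1) (.coset (1 : G))
  let A : Set P := diag '' (insert 1 (C : Set G)) ∪ {a, b}
  have hA : A.Finite := ((C.finite_toSet.insert 1).image diag).union (by simp)
  let T := Subsemigroup.closure A
  have ha : a ∈ T := Subsemigroup.subset_closure (Or.inr (by simp))
  have hb : b ∈ T := Subsemigroup.subset_closure (Or.inr (by simp))
  have hdiag : ∀ g, diag g ∈ T := by
    intro g
    have hg : g ∈ Submonoid.closure (C : Set G) := by rw [hC]; trivial
    induction hg using Submonoid.closure_induction with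
    | mem g hg => exact Subsemigroup.subset_closure (Or.inl ⟨g, Set.mem_insert_of_mem _ hg, rfl⟩)
    | one => exact Subsemigroup.subset_closure (Or.inl ⟨1, Set.mem_insert _ _, rfl⟩)
    | mul g h _ _ hg hh =>
      have := T.mul_mem hg hh
      rwa [pair_mul] at this
  have units : ∀ t ∈ T, ∀ g g' : G, t ⟨false⟩ = .unit g → t ⟨true⟩ = .unit g' → g = g' := by
    intro t ht
    induction ht using Subsemigroup.closure_induction with
    | mem t ht =>
      rintro g g' h h'
      rcases ht with ⟨k, -, rfl⟩ | rfl | rfl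
      · simp only [diag, pair] at h h'
        simp at h h'
        rw [← h, ← h']
      · simp [a, pair] at h
      · simp [b, pair] at h'
    | mul s t _ _ hs ht =>
      rintro g g' h h'
      obtain ⟨g₁, g₂, h₁, h₂, rfl⟩ := LFlatSub.mul_eq_unit h
      obtain ⟨k₁, k₂, l₁, l₂, rfl⟩ := LFlatSub.mul_eq_unit h'
      rw [hs _ _ h₁ l₁, ht _ _ h₂ l₂]
  let x : G → T := fun h => ⟨a * diag h * b, T.mul_mem (T.mul_mem ha (hdiag h)) hb⟩
  have hx : ∀ h : G, (x h : P) = pair (.coset (1 : G)) (.coset (h : G)) := by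
    intro h
    simp only [x, a, b, diag, pair_mul]
    change pair (.coset (1 : G)) (.coset ((1 * h * 1 : G) : G ⧸ (⊥ : Subgroup G))) = _
    simp
  -- `Q t k` says that `t` is a coset pair with quotient `k`.
  let Q : T → G ⧸ (⊥ : Subgroup G) → Prop := fun t k =>
    ∃ c d, (t : P) ⟨false⟩ = .coset c ∧ (t : P) ⟨true⟩ = .coset d ∧ k = c⁻¹ * d
  let N : T → Prop := fun t => ∀ i g, (t : P) i ≠ .unit g
  have hQN : ∀ t k, Q t k → N t := by
    rintro t k ⟨c, d, hc, hd, -⟩ ⟨_ | _⟩ g hg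
    · simp [hc] at hg
    · simp [hd] at hg
  have hN : ∀ s t, N t → N (s * t) := by
    intro s t ht i g hg
    obtain ⟨-, l, -, hl, -⟩ := LFlatSub.mul_eq_unit hg
    exact ht i l hl
  have Q_right : ∀ (s t : T) k, N t → Q (s * t) k → Q t k := by
    rintro s t k hN ⟨c, d, hc, hd, rfl⟩
    rcases LFlatSub.mul_eq_coset hc with ⟨g, c', hs, ht, rfl⟩ | ⟨g, hs, ht⟩
    · rcases LFlatSub.mul_eq_coset hd with ⟨g', d', hs', ht', rfl⟩ | ⟨g', hs', ht'⟩
      · obtain rfl := units s s.2 _ _ hs hs'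
        refine ⟨c', d', ht, ht', ?_⟩
        change ((g : G ⧸ (⊥ : Subgroup G)) * c')⁻¹ * (g * d') = _
        group
      · exact absurd ht' (hN _ _)
    · exact absurd ht (hN _ _)
  have Q_left : ∀ (s t : T) k, N s → Q (s * t) k → Q s k := by
    rintro s t k hN ⟨c, d, hc, hd, rfl⟩
    rcases LFlatSub.mul_eq_coset hc with ⟨g, c', hs, ht, rfl⟩ | ⟨g, hs, ht⟩
    · exact absurd hs (hN _ _)
    · rcases LFlatSub.mul_eq_coset hd with ⟨g', d', hs', ht', rfl⟩ | ⟨g', hs', ht'⟩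
      · exact absurd hs' (hN _ _)
      · exact ⟨c, d, hs, hs', rfl⟩
  have Q_unique : ∀ t k k', Q t k → Q t k' → k = k' := by
    rintro t k k' ⟨c, d, hc, hd, rfl⟩ ⟨c', d', hc', hd', rfl⟩
    rw [hc, LFlatSub.coset.injEq] at hc'
    rw [hd, LFlatSub.coset.injEq] at hd'
    rw [hc', hd']
  have Q_greenJ : ∀ s t k k', greenJ T s t → Q s k → Q t k' → k = k' := by
    intro s t k k' hst hs ht
    have hNt := hQN t k' ht
    refine Q_unique t k k' ?_ ht
    obtain ⟨u, v, h⟩ := greenJ.exists_mul hst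
    have left : ∀ (w : T) (v : WithOne T), N w → (s : WithOne T) = w * v → Q w k := by
      intro w v hw
      refine WithOne.cases_on v (fun h => ?_) fun v h => ?_
      · rw [mul_one] at h
        rwa [← WithOne.coe_inj.1 h]
      · rw [← WithOne.coe_mul] at h
        rw [WithOne.coe_inj.1 h] at hs
        exact Q_left w v k hw hs
    revert h
    refine WithOne.cases_on u (fun h => ?_) fun u h => ?_
    · rw [one_mul] at h
      exact left t v hNt h
    · rw [← WithOne.coe_mul] at h
      exact Q_right u t k hNt (left _ v (hN u t hNt) h)
  have hQx : ∀ h : G, Q (x h) (h : G ⧸ (⊥ : Subgroup G)) := fun h =>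
    ⟨(1 : G), h, by rw [hx]; rfl, by rw [hx]; rfl, by simp⟩
  have hTfg : FinitelyGenerated T :=
    ⟨_, hA.preimage Subtype.val_injective.injOn, Subsemigroup.closure_closure_coe_preimage⟩
  have hfin : Finite (Quotient (greenJ T)) :=
    hJ T (hV.subsemigroup T ⟨a, ha⟩ (hV.pi (fun _ => LFlat G) fun _ => hL)) hTfg
  have : Finite G := by
    refine Finite.of_injective (fun h => Quotient.mk (greenJ T) (x h)) fun h h' hh => ?_
    have := Q_greenJ _ _ _ _ (Quotient.exact hh) (hQx h) (hQx h')
    rw [QuotientGroup.eq, Subgroup.mem_bot, inv_mul_eq_one] at this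
    exact this
  exact not_finite G

/-! ### Periodic monoids with central idempotents -/

/-- The elements of a monoid that are fixed by an idempotent other than `1`. -/
def fixedByProper (M : Type u) [Monoid M] : Set M :=
  {x | ∃ f : M, IsIdempotentElem f ∧ f ≠ 1 ∧ f * x = x}

theorem mul_mem_fixedByProper {M : Type u} [Monoid M] (hc : CentralIdempotents M) {x : M}
    (hx : x ∈ fixedByProper M) (s : M) : s * x ∈ fixedByProper M ∧ x * s ∈ fixedByProper M := by
  obtain ⟨f, hf, h1, hfx⟩ := hx
  exact ⟨⟨f, hf, h1, by rw [← mul_assoc, hc f s hf, mul_assoc, hfx]⟩,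
    ⟨f, hf, h1, by rw [← mul_assoc, hfx]⟩⟩

/-- If `b` is not fixed by a proper idempotent, then `b = p * b * q` forces `p` and `q` to be
units: the central idempotents `p ^ n` and `q ^ n` fix `b`. -/
theorem isUnit_of_eq_mul_mul {M : Type u} [Monoid M] {n : ℕ} (hn : 0 < n)
    (hpow : ∀ x : M, IsIdempotentElem (x ^ n)) (hc : CentralIdempotents M) {b p q : M}
    (hb : b ∉ fixedByProper M) (h : b = p * b * q) : IsUnit p ∧ IsUnit q := by
  have iter : ∀ k : ℕ, b = p ^ k * b * q ^ k := by
    intro k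
    induction k with
    | zero => simp
    | succ k ih =>
      calc b = p ^ k * (p * b * q) * q ^ k := by rw [← h]; exact ih
        _ = _ := by rw [pow_succ, pow_succ' q]; simp only [mul_assoc]
  have one_of : ∀ f : M, IsIdempotentElem f → f * b = b → f = 1 := by
    intro f hf hfb
    by_contra h1
    exact hb ⟨f, hf, h1, hfb⟩
  have hp : p ^ n = 1 := by
    refine one_of _ (hpow p) ?_
    conv_lhs => rw [iter n]
    rw [← mul_assoc, ← mul_assoc, (hpow p).eq]
    exact (iter n).symm
  have hq : q ^ n = 1 := by
    refine one_of _ (hpow q) ?_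
    rw [hc _ _ (hpow q)]
    conv_lhs => rw [iter n]
    rw [mul_assoc, (hpow q).eq]
    exact (iter n).symm
  exact ⟨IsUnit.of_pow_eq_one hp hn.ne', IsUnit.of_pow_eq_one hq hn.ne'⟩

/-- The units `g` with `b * g ∈ Mˣ * b`. -/
def leftMover {M : Type u} [Monoid M] (b : M) : Subgroup Mˣ where
  carrier := {g | ∃ g' : Mˣ, b * g = g' * b}
  one_mem' := ⟨1, by simp⟩
  mul_mem' := by
    rintro g h ⟨g', hg⟩ ⟨h', hh⟩
    exact ⟨g' * h', by rw [Units.val_mul, ← mul_assoc, hg, mul_assoc, hh, Units.val_mul, mul_assoc]⟩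
  inv_mem' := by
    rintro g ⟨g', hg⟩
    exact ⟨g'⁻¹, by rw [Units.mul_inv_eq_iff_eq_mul, mul_assoc, hg, Units.inv_mul_cancel_left]⟩

/-- The relation that exhibits `R♭(G/N)`, where `G = Mˣ` and `N` is the core of `leftMover b`, as a
divisor of the power `M ^ G`. Constant functions with a unit value represent the units, and the
functions `t ↦ l t * b * t * k` represent the coset of `k`; the arbitrary factor `l t ∈ G` divides
out the left action of `G` on `GbG`. -/
inductive rFlatRel {M : Type u} [Monoid M] (b : M) :
    (Mˣ → M) → RFlat (Mˣ ⧸ (leftMover b).normalCore) → Prop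
  | unit (f : Mˣ → M) (g : Mˣ) (h : ∀ t, f t = g) : rFlatRel b f (.unit g)
  | coset (f : Mˣ → M) (l : Mˣ → Mˣ) (k : Mˣ) (h : ∀ t : Mˣ, f t = l t * b * t * k) :
      rFlatRel b f (.coset (Quotient.mk _ (k : Mˣ ⧸ (leftMover b).normalCore)))
  | zero (f : Mˣ → M) (h : ∀ t, ∃ u v : M, f t = u * b * v)
      (h' : ∀ t, ∀ l k : Mˣ, f t ≠ l * b * k) : rFlatRel b f .zero

theorem IsVariety.rFlat_quotient_normalCore {V : ∀ (S : Type u) [Semigroup S], Prop}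
    (hV : IsVariety V) {M : Type u} [Monoid M] (hM : V M) {n : ℕ} (hn : 0 < n)
    (hpow : ∀ x : M, IsIdempotentElem (x ^ n)) (hc : CentralIdempotents M) {b : M}
    (hbu : ¬ IsUnit b) (hb : b ∉ fixedByProper M) :
    V (RFlat (Mˣ ⧸ (leftMover b).normalCore)) := by
  have := isDedekindFiniteMonoid_of_pow hn hpow
  have : Nonempty (RFlat (Mˣ ⧸ (leftMover b).normalCore)) := ⟨.zero⟩
  have not_unit : ∀ u v : M, ¬ IsUnit (u * b * v) := fun u v h =>
    hbu (isUnit_of_mul_isUnit_right (isUnit_of_mul_isUnit_left h))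
  -- Products of two elements of `MbM` lie outside `GbG`.
  have mul_ne : ∀ u v u' v' : M, ∀ l k : Mˣ, u * b * v * (u' * b * v') ≠ l * b * k := by
    intro u v u' v' l k h
    have h2 : b = (↑l⁻¹ * u) * b * (v * (u' * b * v') * ↑k⁻¹) := by
      calc b = ↑l⁻¹ * (l * b * k) * ↑k⁻¹ := by
            simp [mul_assoc]
        _ = _ := by rw [← h]; simp only [mul_assoc]
    have h3 := (isUnit_of_eq_mul_mul hn hpow hc hb h2).2
    exact not_unit _ _ (isUnit_of_mul_isUnit_right (isUnit_of_mul_isUnit_left h3))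
  refine hV.of_relation (hV.pi (fun _ : Mˣ => M) fun _ => hM) (rFlatRel b) ?_ ?_ ?_
  · rintro f _ _ (⟨g, hg⟩ | ⟨l, k, hk⟩ | ⟨h, h'⟩) (⟨g₁, hg₁⟩ | ⟨l₁, k₁, hk₁⟩ | ⟨h₁, h₁'⟩)
    · have : g = g₁ := Units.ext ((hg 1).symm.trans (hg₁ 1))
      rw [this]
    · exact absurd ⟨g, by rw [← hg 1, hk₁ 1, mul_assoc]⟩ (not_unit (l₁ 1) (((1 : Mˣ) : M) * k₁))
    · obtain ⟨u, v, huv⟩ := h₁ 1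
      exact absurd ⟨g, by rw [← hg 1, huv]⟩ (not_unit u v)
    · exact absurd ⟨g₁, by rw [← hg₁ 1, hk 1, mul_assoc]⟩ (not_unit (l 1) (((1 : Mˣ) : M) * k))
    · -- The values at `t` agree iff `t * (k₁ * k⁻¹) * t⁻¹ ∈ leftMover b`; all `t` give the core.
      have hmem : k₁ * k⁻¹ ∈ (leftMover b).normalCore := by
        intro t
        refine ⟨(l₁ t)⁻¹ * l t, ?_⟩
        have h := (hk₁ t).symm.trans (hk t)
        have h' : b * (t : M) * k₁ = ↑(l₁ t)⁻¹ * (l t * b * t * k) := by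
          rw [← h]; simp [mul_assoc]
        have h'' : b * ((t * (k₁ * k⁻¹) * t⁻¹ : Mˣ) : M) = b * (t : M) * k₁ * ↑k⁻¹ * ↑t⁻¹ := by
          simp [mul_assoc]
        rw [h'', h']
        simp [mul_assoc]
      have : (k : Mˣ ⧸ (leftMover b).normalCore) = k₁ := by
        have h := (QuotientGroup.eq_one_iff (N := (leftMover b).normalCore) _).2 hmem
        rw [QuotientGroup.mk_mul, QuotientGroup.mk_inv, mul_inv_eq_one] at h
        exact h.symm
      rw [this]
    · exact absurd (by rw [hk 1, mul_assoc, Units.val_mul]) (h₁' 1 (l 1) (1 * k))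
    · obtain ⟨u, v, huv⟩ := h 1
      exact absurd ⟨g₁, by rw [← hg₁ 1, huv]⟩ (not_unit u v)
    · exact absurd (by rw [hk₁ 1, mul_assoc, Units.val_mul]) (h' 1 (l₁ 1) (1 * k₁))
    · rfl
  · rintro f f₁ _ _ (⟨g, hg⟩ | ⟨l, k, hk⟩ | ⟨h, h'⟩)
      (⟨g₁, hg₁⟩ | ⟨l₁, k₁, hk₁⟩ | ⟨h₁, h₁'⟩)
    · exact .unit _ (g * g₁) fun t => by rw [Pi.mul_apply, hg, hg₁, Units.val_mul]
    · exact .coset _ (fun t => g * l₁ t) k₁ fun t => by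
        rw [Pi.mul_apply, hg, hk₁, Units.val_mul]; simp only [mul_assoc]
    · refine .zero _ (fun t => ?_) fun t l k ht => ?_
      · obtain ⟨u, v, huv⟩ := h₁ t
        exact ⟨g * u, v, by rw [Pi.mul_apply, hg, huv]; simp only [mul_assoc]⟩
      · rw [Pi.mul_apply, hg] at ht
        refine h₁' t (g⁻¹ * l) k ?_
        rw [← Units.inv_mul_cancel_left g (f₁ t), ht, Units.val_mul]
        simp only [mul_assoc]
    · exact .coset _ l (k * g₁) fun t => by
        rw [Pi.mul_apply, hk, hg₁, Units.val_mul]; simp only [mul_assoc]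
    · refine .zero _ (fun t => ?_) fun t l' k' ht => ?_
      · exact ⟨l t, t * k * (l₁ t * b * t * k₁), by
          rw [Pi.mul_apply, hk, hk₁]; simp only [mul_assoc]⟩
      · refine mul_ne (l t) (t * k) (l₁ t) (t * k₁) l' k' ?_
        rw [← ht, Pi.mul_apply, hk, hk₁]
        simp only [mul_assoc]
    · refine .zero _ (fun t => ?_) fun t l' k' ht => ?_
      · exact ⟨l t, t * k * f₁ t, by rw [Pi.mul_apply, hk]; simp only [mul_assoc]⟩
      · obtain ⟨u, v, huv⟩ := h₁ t
        refine mul_ne (l t) (t * k) u v l' k' ?_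
        rw [← ht, Pi.mul_apply, hk, huv]
        simp only [mul_assoc]
    · refine .zero _ (fun t => ?_) fun t l k ht => ?_
      · obtain ⟨u, v, huv⟩ := h t
        exact ⟨u, v * g₁, by rw [Pi.mul_apply, hg₁, huv]; simp only [mul_assoc]⟩
      · rw [Pi.mul_apply, hg₁] at ht
        refine h' t l (k * g₁⁻¹) ?_
        rw [← Units.mul_inv_cancel_right (f t) g₁, ht, Units.val_mul]
        simp only [mul_assoc]
    · refine .zero _ (fun t => ?_) fun t l' k' ht => ?_
      · exact ⟨f t * l₁ t, t * k₁, by rw [Pi.mul_apply, hk₁]; simp only [mul_assoc]⟩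
      · obtain ⟨u, v, huv⟩ := h t
        refine mul_ne u v (l₁ t) (t * k₁) l' k' ?_
        rw [← ht, Pi.mul_apply, hk₁, huv]
        simp only [mul_assoc]
    · refine .zero _ (fun t => ?_) fun t l' k' ht => ?_
      · obtain ⟨u, v, huv⟩ := h₁ t
        exact ⟨f t * u, v, by rw [Pi.mul_apply, huv]; simp only [mul_assoc]⟩
      · obtain ⟨u, v, huv⟩ := h t
        obtain ⟨u', v', huv'⟩ := h₁ t
        refine mul_ne u v u' v' l' k' ?_
        rw [← ht, Pi.mul_apply, huv, huv']
  · rintro (g | c | _)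
    · induction g using QuotientGroup.induction_on with
      | H g => exact ⟨fun _ => g, .unit _ g fun _ => rfl⟩
    · induction c using Quotient.inductionOn with
      | h c =>
        induction c using QuotientGroup.induction_on with
        | H k => exact ⟨fun t => (1 : Mˣ) * b * t * k, .coset _ (fun _ => 1) k fun _ => rfl⟩
    · exact ⟨fun _ => b * b, .zero _ (fun _ => ⟨b, 1, by simp⟩) fun _ l k h =>
        mul_ne 1 1 1 1 l k (by simpa using h)⟩

/-- The group of units of a finitely generated monoid in which one-sided inverses are two-sided is
generated by the units among the generators. -/
theorem fg_units {M : Type u} [Monoid M] [IsDedekindFiniteMonoid M] (h : FinitelyGenerated M) :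
    Group.FG Mˣ := by
  obtain ⟨A, hA, htop⟩ := h
  rw [Group.fg_iff]
  refine ⟨((↑) : Mˣ → M) ⁻¹' A, ?_, hA.preimage Units.val_injective.injOn⟩
  have key : ∀ x : M, ∀ g : Mˣ, (g : M) = x → g ∈ Subgroup.closure (((↑) : Mˣ → M) ⁻¹' A) := by
    intro x
    have hx : x ∈ Subsemigroup.closure A := by rw [htop]; trivial
    induction hx using Subsemigroup.closure_induction with
    | mem x hx =>
      rintro g rfl
      exact Subgroup.subset_closure hx
    | mul x y _ _ hx hy =>
      intro g hg
      have hu : IsUnit (x * y) := ⟨g, hg⟩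
      obtain ⟨p, rfl⟩ := isUnit_of_mul_isUnit_left hu
      obtain ⟨q, rfl⟩ := isUnit_of_mul_isUnit_right hu
      rw [← Units.val_mul, Units.val_inj] at hg
      rw [hg]
      exact mul_mem (hx p rfl) (hy q rfl)
  exact eq_top_iff.2 fun g _ => key g g rfl

/-- If `V` contains no `R♭(G)` for a Novikov--Adian group `G`, then `leftMover b` has finite index,
and the coset representatives form a finite set `R` with `b * Mˣ ⊆ Mˣ * b * R`. -/
theorem IsVariety.exists_finite_transversal {V : ∀ (S : Type u) [Semigroup S], Prop}
    (hV : IsVariety V)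
    (hR : ∀ (G : Type u) [Group G], IsNovikovAdian G → ¬ V (RFlat G))
    {M : Type u} [Monoid M] (hM : V M) (hfg : FinitelyGenerated M) {n : ℕ} (hn : 0 < n)
    (hpow : ∀ x : M, IsIdempotentElem (x ^ n)) (hc : CentralIdempotents M) {b : M}
    (hbu : ¬ IsUnit b) (hb : b ∉ fixedByProper M) :
    ∃ R : Set Mˣ, R.Finite ∧ ∀ g : Mˣ, ∃ s ∈ R, ∃ g' : Mˣ, b * g = g' * (b * s) := by
  have := isDedekindFiniteMonoid_of_pow hn hpow
  have hVR := hV.rFlat_quotient_normalCore hM hn hpow hc hbu hb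
  set N := (leftMover b).normalCore with hN
  have hfgG : Group.FG Mˣ := fg_units hfg
  have hexp : Monoid.ExponentExists (Mˣ ⧸ N) := by
    refine ⟨n, hn, fun q => ?_⟩
    induction q using QuotientGroup.induction_on with
    | H g =>
      have hg : IsIdempotentElem (g ^ n) :=
        Units.ext (by simpa using (hpow (g : M)).eq)
      rw [← QuotientGroup.mk_pow, IsIdempotentElem.iff_eq_one.1 hg, QuotientGroup.mk_one]
  have hfin : Finite (Mˣ ⧸ N) := by
    by_contra hinf
    exact hR _ ⟨not_finite_iff_infinite.1 hinf, inferInstance, hexp⟩ hVR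
  refine ⟨Set.range fun q : Mˣ ⧸ N => (Quotient.out q : Mˣ), Set.finite_range _, fun g => ?_⟩
  refine ⟨_, ⟨(g : Mˣ ⧸ N), rfl⟩, ?_⟩
  set s : Mˣ := Quotient.out (g : Mˣ ⧸ N)
  have hs : (s : Mˣ ⧸ N) = g := Quotient.out_eq' _
  have hmem : g * s⁻¹ ∈ N := by
    rw [← QuotientGroup.eq_one_iff, QuotientGroup.mk_mul, QuotientGroup.mk_inv, hs, mul_inv_cancel]
  obtain ⟨g', hg'⟩ := Subgroup.normalCore_le _ hmem
  refine ⟨g', ?_⟩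
  rw [← mul_assoc, ← hg', mul_assoc, ← Units.val_mul, inv_mul_cancel_right]

/-- The elements outside `fixedByProper M` fall into finitely many orbits of the left action
of `Mˣ`. -/
theorem IsVariety.exists_finite_orbits {V : ∀ (S : Type u) [Semigroup S], Prop}
    (hV : IsVariety V) (hper : ∀ (S : Type u) [Semigroup S], V S → Periodic S)
    (hcen : ∀ (S : Type u) [Semigroup S], V S → CentralIdempotents S)
    (hnil : ∀ (S : Type u) [Semigroup S], V S → IsNil S → LocallyFinite S)
    (hR : ∀ (G : Type u) [Group G], IsNovikovAdian G → ¬ V (RFlat G))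
    {M : Type u} [Monoid M] (hM : V M) (hfg : FinitelyGenerated M) :
    ∃ F : Set M, F.Finite ∧ ∀ x ∉ fixedByProper M, ∃ y ∈ F, ∃ g : Mˣ, x = g * y := by
  obtain ⟨n, hn, hpow⟩ := hV.exists_pow_idempotent hper hM
  have hc := hcen M hM
  have := isDedekindFiniteMonoid_of_pow hn hpow
  obtain ⟨C, hC, htop⟩ := id hfg
  let B : Set M := {b ∈ C | ¬ IsUnit b ∧ b ∉ fixedByProper M}
  have hB : B.Finite := hC.subset fun _ h => h.1
  choose! R hRfin hRprop using fun (b : M) (hb : b ∈ B) =>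
    hV.exists_finite_transversal hR hM hfg hn hpow hc hb.2.1 hb.2.2
  let A : Set M := ⋃ b ∈ B, (fun s : Mˣ => b * (s : M)) '' R b
  have hA : A.Finite := hB.biUnion fun b hb => (hRfin b hb).image _
  have mem_A : ∀ b ∈ B, ∀ s ∈ R b, b * s ∈ A := fun b hb s hs =>
    Set.mem_biUnion hb ⟨s, hs, rfl⟩
  have nonunit : ∀ y ∈ Subsemigroup.closure A, ¬ IsUnit y := by
    intro y hy
    induction hy using Subsemigroup.closure_induction with
    | mem y hy =>
      obtain ⟨b, hb, s, -, rfl⟩ := Set.mem_iUnion₂.1 hy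
      exact fun h => hb.2.1 (isUnit_of_mul_isUnit_left h)
    | mul x y _ _ hx _ => exact fun h => hx (isUnit_of_mul_isUnit_left h)
  -- Units can be moved from the right of an element of the closure to its left.
  have move : ∀ y ∈ Subsemigroup.closure A, ∀ g : Mˣ,
      ∃ g' : Mˣ, ∃ y' ∈ Subsemigroup.closure A, y * g = g' * y' := by
    intro y hy
    induction hy using Subsemigroup.closure_induction with
    | mem y hy =>
      obtain ⟨b, hb, s, hs, rfl⟩ := Set.mem_iUnion₂.1 hy
      intro g
      obtain ⟨s', hs', g', h⟩ := hRprop b hb (s * g)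
      refine ⟨g', _, Subsemigroup.subset_closure (mem_A b hb s' hs'), ?_⟩
      rw [← h, Units.val_mul]
      exact mul_assoc _ _ _
    | mul x y _ _ hx hy =>
      intro g
      obtain ⟨g₁, y₁, hy₁, h₁⟩ := hy g
      obtain ⟨g₂, x₁, hx₁, h₂⟩ := hx g₁
      exact ⟨g₂, x₁ * y₁, mul_mem hx₁ hy₁, by
        rw [mul_assoc, h₁, ← mul_assoc, h₂, mul_assoc]⟩
  have normal_form : ∀ x : M, x ∈ fixedByProper M ∨ IsUnit x ∨
      ∃ g : Mˣ, ∃ y ∈ Subsemigroup.closure A, x = g * y := by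
    intro x
    have hx : x ∈ Subsemigroup.closure C := by rw [htop]; trivial
    induction hx using Subsemigroup.closure_induction with
    | mem x hx =>
      by_cases h1 : x ∈ fixedByProper M
      · exact Or.inl h1
      by_cases h2 : IsUnit x
      · exact Or.inr (Or.inl h2)
      obtain ⟨s, hs, g, h⟩ := hRprop x ⟨hx, h2, h1⟩ 1
      rw [Units.val_one, mul_one] at h
      exact Or.inr (Or.inr ⟨g, _, Subsemigroup.subset_closure (mem_A x ⟨hx, h2, h1⟩ s hs), h⟩)
    | mul x x' _ _ hx hx' =>
      rcases hx with hx | hx | ⟨g, y, hy, rfl⟩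
      · exact Or.inl (mul_mem_fixedByProper hc hx _).2
      · rcases hx' with hx' | hx' | ⟨g', y', hy', rfl⟩
        · exact Or.inl (mul_mem_fixedByProper hc hx' _).1
        · exact Or.inr (Or.inl (hx.mul hx'))
        · obtain ⟨p, rfl⟩ := hx
          exact Or.inr (Or.inr ⟨p * g', y', hy', by rw [Units.val_mul, mul_assoc]⟩)
      · rcases hx' with hx' | ⟨p, rfl⟩ | ⟨g', y', hy', rfl⟩
        · exact Or.inl (mul_mem_fixedByProper hc hx' _).1
        · obtain ⟨g₁, y₁, hy₁, h₁⟩ := move y hy p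
          exact Or.inr (Or.inr ⟨g * g₁, y₁, hy₁, by
            rw [Units.val_mul, mul_assoc, h₁, mul_assoc]⟩)
        · obtain ⟨g₁, y₁, hy₁, h₁⟩ := move y hy g'
          refine Or.inr (Or.inr ⟨g * g₁, y₁ * y', mul_mem hy₁ hy', ?_⟩)
          calc g * y * (g' * y') = g * (y * g') * y' := by simp only [mul_assoc]
            _ = _ := by rw [h₁, Units.val_mul]; simp only [mul_assoc]
  have hfin := hV.finite_closure_diff hnil hM hA (fixedByProper M)
    (fun x hx s => mul_mem_fixedByProper hc hx s) fun s hs => by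
      obtain ⟨e, he, hi⟩ := (hper M hM).exists_idempotent s
      obtain ⟨k, hk, rfl⟩ := exists_pow_of_mem_closure_singleton he
      exact ⟨_, he, s ^ k, hi, fun h1 => nonunit s hs (IsUnit.of_pow_eq_one h1 hk.ne'), hi⟩
  refine ⟨insert 1 ((Subsemigroup.closure A : Set M) \ fixedByProper M), hfin.insert 1,
    fun x hx => ?_⟩
  rcases normal_form x with h | ⟨g, rfl⟩ | ⟨g, y, hy, rfl⟩
  · exact absurd h hx
  · exact ⟨1, Set.mem_insert _ _, g, (mul_one _).symm⟩
  · exact ⟨y, Set.mem_insert_of_mem _ ⟨hy, fun h => hx (mul_mem_fixedByProper hc h _).1⟩, g, rfl⟩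

/-! ### Local monoids at central idempotents -/

/-- The local monoid `eS` of a central idempotent `e`, as the set of elements fixed by `e`. -/
@[ext]
structure LocalMonoid {S : Type u} [Semigroup S] (e : S) (he : IsIdempotentElem e)
    (hc : ∀ s, e * s = s * e) : Type u where
  val : S
  fixed : e * val = val

namespace LocalMonoid

variable {S : Type u} [Semigroup S] {e : S} {he : IsIdempotentElem e} {hc : ∀ s, e * s = s * e}

instance : Monoid (LocalMonoid e he hc) where
  mul x y := ⟨x.1 * y.1, by rw [← mul_assoc, x.2]⟩
  mul_assoc x y z := LocalMonoid.ext (mul_assoc x.1 y.1 z.1)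
  one := ⟨e, he⟩
  one_mul x := LocalMonoid.ext x.2
  mul_one x := LocalMonoid.ext ((hc x.1).symm.trans x.2)

variable (e he hc) in
/-- Multiplication by `e`, as a homomorphism from `S` onto `eS`. -/
def proj : S →ₙ* LocalMonoid e he hc where
  toFun s := ⟨e * s, by rw [← mul_assoc, he.eq]⟩
  map_mul' s t := LocalMonoid.ext (by
    change e * (s * t) = e * s * (e * t)
    rw [← mul_assoc (e * s), mul_assoc e s e, ← hc s, ← mul_assoc e e s, he.eq, mul_assoc])

theorem proj_val (x : LocalMonoid e he hc) : proj e he hc x.1 = x := LocalMonoid.ext x.2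

theorem proj_surjective : Function.Surjective (proj e he hc) := fun x => ⟨x.1, proj_val x⟩

theorem finitelyGenerated (h : FinitelyGenerated S) : FinitelyGenerated (LocalMonoid e he hc) := by
  obtain ⟨A, hA, htop⟩ := h
  refine ⟨proj e he hc '' A, hA.image _, ?_⟩
  rw [← MulHom.map_mclosure, htop, eq_top_iff]
  exact fun x _ => ⟨x.1, trivial, proj_val x⟩

end LocalMonoid

/-- A finitely generated semigroup `S` in the variety has finitely many idempotents: `e` is
determined by the set of the generators that become units in `eS`, since a product is a unit if
and only if its factors are, and `f` becomes a unit in `eS` if and only if `e * f = e`. -/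
theorem IsVariety.finite_idempotents {V : ∀ (S : Type u) [Semigroup S], Prop}
    (hV : IsVariety V) (hper : ∀ (S : Type u) [Semigroup S], V S → Periodic S)
    (hcen : ∀ (S : Type u) [Semigroup S], V S → CentralIdempotents S)
    {S : Type u} [Semigroup S] (hS : V S) (hfg : FinitelyGenerated S) :
    {e : S | IsIdempotentElem e}.Finite := by
  obtain ⟨A, hA, htop⟩ := hfg
  have hc : ∀ e s : S, IsIdempotentElem e → e * s = s * e := hcen S hS
  let φ : ∀ e : {e : S // IsIdempotentElem e}, S →ₙ* LocalMonoid e.1 e.2 (fun s => hc _ s e.2) :=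
    fun e => LocalMonoid.proj e.1 e.2 (fun s => hc _ s e.2)
  have hunit_mul : ∀ e x y, IsUnit (φ e (x * y)) ↔ IsUnit (φ e x) ∧ IsUnit (φ e y) := by
    intro e x y
    obtain ⟨n, hn, hpow⟩ := hV.exists_pow_idempotent hper
      (hV.of_surjective (φ e) LocalMonoid.proj_surjective hS)
    have := isDedekindFiniteMonoid_of_pow hn hpow
    rw [map_mul, IsUnit.mul_iff]
  have hunit_idem : ∀ e f : {e : S // IsIdempotentElem e}, IsUnit (φ e f.1) → e.1 * f.1 = e.1 := by
    intro e f h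
    have hi : IsIdempotentElem (φ e f.1) := by
      rw [IsIdempotentElem, ← map_mul, f.2.eq]
    exact congrArg LocalMonoid.val ((IsIdempotentElem.iff_eq_one_of_isUnit h).1 hi)
  let χ : {e : S // IsIdempotentElem e} → Set A := fun e => {a | IsUnit (φ e a.1)}
  have hχ : ∀ e f, χ e = χ f → ∀ x, IsUnit (φ e x) ↔ IsUnit (φ f x) := by
    intro e f h x
    have hx : x ∈ Subsemigroup.closure A := by rw [htop]; trivial
    induction hx using Subsemigroup.closure_induction with
    | mem x hx => exact Set.ext_iff.1 h ⟨x, hx⟩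
    | mul x y _ _ hx hy =>
      exact (hunit_mul e x y).trans ((and_congr hx hy).trans (hunit_mul f x y).symm)
  have hself : ∀ e, IsUnit (φ e e.1) := fun e => by
    have : φ e e.1 = 1 := LocalMonoid.ext e.2
    rw [this]; exact isUnit_one
  have : Finite A := hA
  have hfin : Finite {e : S // IsIdempotentElem e} := by
    refine Finite.of_injective χ fun e f h => Subtype.ext ?_
    have h1 := hunit_idem e f ((hχ e f h _).2 (hself f))
    have h2 := hunit_idem f e ((hχ e f h _).1 (hself e))
    rw [← h1, hc _ _ e.2, h2]
  exact hfin

/-- If some idempotent fixes `x`, then there is a least one `e` in the order in which `e ≤ f` means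
`f * e = e`, and `x` is fixed by no proper idempotent of `eS`. -/
theorem exists_least_idempotent {S : Type u} [Semigroup S]
    (hc : ∀ e s : S, IsIdempotentElem e → e * s = s * e)
    (hfin : {e : S | IsIdempotentElem e}.Finite) {x f : S} (hf : IsIdempotentElem f)
    (hfx : f * x = x) :
    ∃ (e : S) (he : IsIdempotentElem e) (hx : e * x = x),
      (⟨x, hx⟩ : LocalMonoid e he fun s => hc e s he) ∉ fixedByProper _ := by
  have hE : {e : S | IsIdempotentElem e ∧ e * x = x}.Finite := hfin.subset fun _ h => h.1
  obtain ⟨e, ⟨he, hx⟩, hmin⟩ :=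
    hE.exists_minimalFor (fun e => {g : S | e * g = g}) _ ⟨f, hf, hfx⟩
  refine ⟨e, he, hx, ?_⟩
  rintro ⟨⟨j, hj⟩, hji, hj1, hjx⟩
  have hji' : j * j = j := congrArg LocalMonoid.val hji
  have hjx' : j * x = x := congrArg LocalMonoid.val hjx
  have hle : {g : S | j * g = g} ⊆ {g : S | e * g = g} := by
    intro g hg
    change e * g = g
    rw [← show j * g = g from hg, ← mul_assoc, hj]
  have hje : j * e = e := hmin ⟨hji', hjx'⟩ hle he
  exact hj1 (LocalMonoid.ext (hj.symm.trans ((hc e j he).trans hje)))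

/-! ### Sufficiency -/

theorem IsVariety.locallyJFinite {V : ∀ (S : Type u) [Semigroup S], Prop}
    (hV : IsVariety V) (hper : ∀ (S : Type u) [Semigroup S], V S → Periodic S)
    (hcen : ∀ (S : Type u) [Semigroup S], V S → CentralIdempotents S)
    (hnil : ∀ (S : Type u) [Semigroup S], V S → IsNil S → LocallyFinite S)
    (hR : ∀ (G : Type u) [Group G], IsNovikovAdian G → ¬ V (RFlat G)) :
    LocallyJFinite V := by
  intro S _ hS hfg
  have hc : ∀ e s : S, IsIdempotentElem e → e * s = s * e := hcen S hS
  have hidem := hV.finite_idempotents hper hcen hS hfg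
  -- The elements that no idempotent fixes form the complement of an ideal with nil quotient.
  let I : Set S := {x | ∃ f : S, IsIdempotentElem f ∧ f * x = x}
  have hI : (Iᶜ : Set S).Finite := by
    obtain ⟨A, hA, htop⟩ := id hfg
    have h := hV.finite_closure_diff hnil hS hA I ?_ ?_
    · rw [htop] at h
      exact h.subset fun x hx => ⟨trivial, hx⟩
    · rintro x ⟨f, hf, hfx⟩ s
      exact ⟨⟨f, hf, by rw [← mul_assoc, hc f s hf, mul_assoc, hfx]⟩,
        ⟨f, hf, by rw [← mul_assoc, hfx]⟩⟩
    · intro s _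
      obtain ⟨e, he, hi⟩ := (hper S hS).exists_idempotent s
      exact ⟨e, he, e, hi, hi⟩
  have orbits : ∀ e : {e : S // IsIdempotentElem e},
      ∃ F : Set (LocalMonoid e.1 e.2 fun s => hc _ s e.2), F.Finite ∧
        ∀ x ∉ fixedByProper _, ∃ y ∈ F, ∃ g : (LocalMonoid e.1 e.2 fun s => hc _ s e.2)ˣ,
          x = g * y := fun e =>
    hV.exists_finite_orbits hper hcen hnil hR
      (hV.of_surjective _ LocalMonoid.proj_surjective hS) (LocalMonoid.finitelyGenerated hfg)
  choose F hF hFprop using orbits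
  have : Finite {e : S // IsIdempotentElem e} := hidem
  refine jFinite_of_finite (F := Iᶜ ∪ ⋃ e, LocalMonoid.val '' F e)
    (hI.union (Set.finite_iUnion fun e => (hF e).image _)) fun x => ?_
  by_cases hx : x ∈ I
  · obtain ⟨f, hf, hfx⟩ := hx
    obtain ⟨e, he, hex, hprop⟩ := exists_least_idempotent hc hidem hf hfx
    obtain ⟨y, hy, g, hg⟩ := hFprop ⟨e, he⟩ _ hprop
    refine ⟨y.1, Or.inr (Set.mem_iUnion.2 ⟨⟨e, he⟩, y, hy, rfl⟩), ?_⟩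
    have hg' : y = g⁻¹.1 * ⟨x, hex⟩ := by rw [hg, Units.inv_mul_cancel_left]
    exact greenJ_of_mul (congrArg LocalMonoid.val hg) (congrArg LocalMonoid.val hg')
  · exact ⟨x, Or.inl hx, (greenJ S).refl x⟩

end SemigroupVarieties

theorem mainTheorem5 (V : ∀ (S : Type u) [Semigroup S], Prop)
    (hV : SemigroupVarieties.IsVariety V)
    (hper : ∀ (S : Type u) [Semigroup S], V S → SemigroupVarieties.Periodic S)
    (hcen : ∀ (S : Type u) [Semigroup S], V S → SemigroupVarieties.CentralIdempotents S) :
    SemigroupVarieties.LocallyJFinite V ↔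
      (∀ (S : Type u) [Semigroup S], V S → SemigroupVarieties.IsNil S →
        SemigroupVarieties.LocallyFinite S) ∧
      (∀ (G : Type u) [Group G], SemigroupVarieties.IsNovikovAdian G →
        ¬ V (SemigroupVarieties.LFlat G) ∧ ¬ V (SemigroupVarieties.RFlat G)) := by
  constructor
  · intro hJ
    refine ⟨fun S _ hS hnil => hJ.locallyFinite_of_isNil hV hS hnil, fun G _ hG => ?_⟩
    have hL := hJ.not_lFlat hV hG
    exact ⟨hL, fun h => hL (hV.lFlat_of_rFlat h)⟩
  · rintro ⟨hnil, hLR⟩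
    exact hV.locallyJFinite hper hcen hnil fun G _ hG => (hLR G hG).2
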